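/- Call a partially ordered set $T$ a tree if $\{s\in T: s<t\}$ is well-ordered for every $t\in T$. A Suslin tree is an uncountable tree in which every chain and every antichain is countable, and the Suslin Hypothesis is the statement that there is no Suslin tree. All topological spaces are assumed to be Hausdorff. For open subsets $U,V$ of a topological space $X$ write $U\le V$ if $\overline U\subseteq V$ or $U=V$. A tunnel in $X$ is a family $\mathscr U$ of open subsets of $X$ that is linearly ordered by $\le$ and such that $\bigcup\{\partial U: U\in\mathscr U\}$ is dense in $X$. A space is ccc if every family of pairwise disjoint nonempty open subsets is countable, and zero-dimensional if its clopen subsets form a base of the topology. **Proposition.** The Suslin Hypothesis holds if and only if every ccc compact zero-dimensional (Hausdorff) space without isolated points has a tunnel. -/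

import Mathlib

namespace SuslinTunnel

/-- A *tree*: a partially ordered set in which the strict predecessors of every element are
well-ordered. -/
def IsTree (T : Type*) [PartialOrder T] : Prop :=
  ∀ t : T, IsWellOrder (Set.Iio t) (· < ·)

/-- A *Suslin tree*: an uncountable tree in which every chain and every antichain is countable.
(In a tree, two incomparable elements have no common upper bound, so antichains with respect to
incomparability and with respect to incompatibility are the same.) -/
structure IsSuslinTree (T : Type*) [PartialOrder T] : Prop where
  isTree : IsTree T
  uncountable : Uncountable T
  countable_of_isChain : ∀ C : Set T, IsChain (· ≤ ·) C → C.Countable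
  countable_of_isAntichain : ∀ A : Set T, IsAntichain (· ≤ ·) A → A.Countable

/-- The *Suslin Hypothesis*: there is no Suslin tree. (A Suslin tree has cardinality `ℵ₁`, so every
one of them, in whatever universe, is isomorphic to one in `Type`.) -/
def SuslinHypothesis : Prop :=
  ∀ (T : Type) [PartialOrder T], ¬ IsSuslinTree T

variable {X : Type*} [TopologicalSpace X]

/-- The relation `U ≤ V` on open sets: `closure U ⊆ V` or `U = V`. -/
def ClosureLE (U V : Set X) : Prop :=
  closure U ⊆ V ∨ U = V

/-- A *chain of open sets*: a family of open sets linearly ordered by `ClosureLE`. -/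
def IsOpenChain (𝒰 : Set (Set X)) : Prop :=
  (∀ U ∈ 𝒰, IsOpen U) ∧ ∀ U ∈ 𝒰, ∀ V ∈ 𝒰, ClosureLE U V ∨ ClosureLE V U

/-- A *tunnel*: a chain of open sets the union of whose boundaries is dense. -/
def IsTunnel (𝒰 : Set (Set X)) : Prop :=
  IsOpenChain 𝒰 ∧ Dense (⋃ U ∈ 𝒰, frontier U)

variable (X)

/-- The space `X` has a tunnel. -/
def HasTunnel : Prop :=
  ∃ 𝒰 : Set (Set X), IsTunnel 𝒰

/-- The countable chain condition: every family of pairwise disjoint nonempty open sets is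
countable. -/
def IsCCC : Prop :=
  ∀ 𝒰 : Set (Set X), (∀ U ∈ 𝒰, IsOpen U ∧ U.Nonempty) → 𝒰.PairwiseDisjoint id → 𝒰.Countable

/-- A space is zero-dimensional if its clopen sets form a base of the topology. -/
def IsZeroDimensional : Prop :=
  TopologicalSpace.IsTopologicalBasis {U : Set X | IsClopen U}

/-- The space `X` has no isolated points. -/
def HasNoIsolatedPoints : Prop :=
  ∀ x : X, ¬ IsOpen ({x} : Set X)

end SuslinTunnel

/-!
Suppose first that there is no Suslin tree, and let `K` be a space as in the theorem. A continuous
`f : K → ℝ` that is constant on no nonempty open set yields the tunnel of the sets `{f < r}`, and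
such an `f` exists as soon as some countable family of clopen sets is *decided* by no nonempty open
set `V`, in the sense that `V` always splits some member of the family
(`hasTunnel_of_not_decides`). If there is no such family then, by the countable chain condition,
there is a nonempty open `W` in which the open sets deciding any given countable family are dense.
A recursion of length `ω₁`, each step of which chooses a maximal disjoint family of clopen subsets
of `W` deciding everything chosen before, produces a Suslin tree
(`exists_isSuslinTree_of_decides`).

Conversely, let `T` be a Suslin tree. In the compact space of paths through `T`, the condensation
points of the initial segments `{s | s ≤ t}` form a space `pathSpace T`, which is compact,
zero-dimensional, ccc and without isolated points. It has no tunnel: for all but countably many `t`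
there is a member `U` of the tunnel that splits the cone of paths through `t` and, for some `s < t`,
contains all or none of those paths through `s` that branch off before `t`
(`IsTunnel.exists_lt_forall_mem`). By a pressing-down argument one `s` serves uncountably many `t`.
Two of these, with incomparable sets of predecessors, have sets `U`, `U'` each of which contains
all, or each of which contains none, of the cone that the other one splits, so that neither
`U ≤ U'` nor `U' ≤ U` is possible (`not_hasTunnel_pathSpace`).
-/

namespace SuslinTunnel

/-! ### Trees -/

section Tree

variable {T : Type*} [PartialOrder T]

theorem IsTree.le_or_le (hT : IsTree T) {a b t : T} (ha : a ≤ t) (hb : b ≤ t) : a ≤ b ∨ b ≤ a := by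
  rcases ha.eq_or_lt with rfl | ha
  · exact Or.inr hb
  rcases hb.eq_or_lt with rfl | hb
  · exact Or.inl ha.le
  have := hT t
  rcases trichotomous_of (· < ·) (⟨a, ha⟩ : Set.Iio t) ⟨b, hb⟩ with h | h | h
  · exact Or.inl (Subtype.mk_lt_mk.1 h).le
  · exact Or.inl (congrArg Subtype.val h).le
  · exact Or.inr (Subtype.mk_lt_mk.1 h).le

theorem IsTree.exists_minimal (hT : IsTree T) {S : Set T} (hS : S.Nonempty) :
    ∃ m ∈ S, ∀ x ∈ S, ¬ x < m := by
  obtain ⟨t, ht⟩ := hS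
  by_cases h : ∃ x ∈ S, x < t
  · obtain ⟨x, hx, hxt⟩ := h
    have := hT t
    have wf : WellFounded ((· < ·) : Set.Iio t → Set.Iio t → Prop) := IsWellFounded.wf
    obtain ⟨m, hm, hmin⟩ := wf.has_min {y : Set.Iio t | (y : T) ∈ S} ⟨⟨x, hxt⟩, hx⟩
    exact ⟨m, hm, fun y hy hym => hmin ⟨y, hym.trans m.2⟩ hy hym⟩
  · push Not at h
    exact ⟨t, ht, h⟩

theorem isTree_of_exists_minimal (hmin : ∀ S : Set T, S.Nonempty → ∃ m ∈ S, ∀ x ∈ S, ¬ x < m)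
    (hle : ∀ a b t : T, a ≤ t → b ≤ t → a ≤ b ∨ b ≤ a) : IsTree T := by
  intro t
  have wf : WellFounded ((· < ·) : T → T → Prop) := WellFounded.wellFounded_iff_has_min.2 hmin
  refine { wf := InvImage.wf Subtype.val wf, trichotomous := ?_ }
  rintro ⟨a, ha⟩ ⟨b, hb⟩ hab hba
  rw [Subtype.mk_lt_mk] at hab hba
  refine Subtype.ext ?_
  rcases hle a b t (le_of_lt ha) (le_of_lt hb) with h | h
  · exact h.eq_of_not_lt hab
  · exact (h.eq_of_not_lt hba).symm

theorem IsSuslinTree.of_orderIso {S : Type*} [PartialOrder S] (hT : IsSuslinTree T) (e : S ≃o T) :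
    IsSuslinTree S where
  isTree := by
    refine isTree_of_exists_minimal (fun A hA => ?_) fun a b t ha hb => ?_
    · obtain ⟨_, ⟨m, hm, rfl⟩, h⟩ := hT.isTree.exists_minimal (hA.image e)
      exact ⟨m, hm, fun x hx hxm => h _ ⟨x, hx, rfl⟩ (e.lt_iff_lt.2 hxm)⟩
    · simpa using hT.isTree.le_or_le (e.monotone ha) (e.monotone hb)
  uncountable := by
    have := hT.uncountable
    exact e.symm.injective.uncountable
  countable_of_isChain C hC := by
    have h := hT.countable_of_isChain (e '' C) (hC.image e)
    exact Set.countable_of_injective_of_countable_image e.injective.injOn h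
  countable_of_isAntichain A hA := by
    have h := hT.countable_of_isAntichain (e '' A) (hA.image_iso e)
    exact Set.countable_of_injective_of_countable_image e.injective.injOn h

end Tree

/-! ### Tunnels from nowhere locally constant functions -/

section Tunnel

variable {K : Type*} [TopologicalSpace K]

/-- The sublevel sets `{f < r}` form the tunnel: on a clopen set, `f` attains its maximum `r` at
some point, and since `f` is not constant near that point, it lies on the boundary of `{f < r}`. -/
theorem hasTunnel_of_forall_exists_ne [CompactSpace K] (hz : IsZeroDimensional K) {f : K → ℝ}
    (hf : Continuous f) (hne : ∀ V : Set K, IsOpen V → V.Nonempty → ∃ x ∈ V, ∃ y ∈ V, f x ≠ f y) :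
    HasTunnel K := by
  refine ⟨Set.range fun r : ℝ => {x | f x < r}, ⟨?_, ?_⟩, ?_⟩
  · rintro _ ⟨r, rfl⟩
    exact isOpen_lt hf continuous_const
  · have key : ∀ r s : ℝ, r ≤ s → ClosureLE {x | f x < r} {x | f x < s} := by
      intro r s hrs
      rcases hrs.eq_or_lt with rfl | hrs
      · exact Or.inr rfl
      · exact Or.inl fun x hx =>
          (show f x ≤ r from closure_lt_subset_le hf continuous_const hx).trans_lt hrs
    rintro _ ⟨r, rfl⟩ _ ⟨s, rfl⟩
    exact (le_total r s).imp (key r s) (key s r)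
  · rw [dense_iff_inter_open]
    rintro O hO ⟨z, hz'⟩
    obtain ⟨V, hV, hzV, hVO⟩ := hz.exists_subset_of_mem_open hz' hO
    obtain ⟨x, hxV, hmax⟩ := hV.isClosed.isCompact.exists_isMaxOn ⟨z, hzV⟩ hf.continuousOn
    refine ⟨x, hVO hxV, Set.mem_iUnion₂.2 ⟨_, ⟨f x, rfl⟩, ?_⟩⟩
    rw [(isOpen_lt hf continuous_const).frontier_eq]
    refine ⟨mem_closure_iff.2 fun W hW hxW => ?_, lt_irrefl (f x)⟩
    obtain ⟨a, ha, b, hb, hab⟩ := hne (W ∩ V) (hW.inter hV.isOpen) ⟨x, hxW, hxV⟩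
    rcases (isMaxOn_iff.1 hmax a ha.2).eq_or_lt with h | h
    · rcases (isMaxOn_iff.1 hmax b hb.2).eq_or_lt with h' | h'
      · exact absurd (h.trans h'.symm) hab
      · exact ⟨b, hb.1, h'⟩
    · exact ⟨a, ha.1, h⟩

/-- `Decides V A`: the set `V` lies inside `A` or inside its complement. -/
def Decides (V A : Set K) : Prop :=
  V ⊆ A ∨ Disjoint V A

/-- The characteristic functions of countably many clopen sets combine into a continuous map to the
Cantor set, which is constant on an open set only if that set decides all of them. -/
theorem hasTunnel_of_not_decides [CompactSpace K] (hz : IsZeroDimensional K) {𝒜 : Set (Set K)}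
    (h𝒜 : 𝒜.Countable) (hclopen : ∀ A ∈ 𝒜, IsClopen A)
    (hnd : ∀ V : Set K, IsOpen V → V.Nonempty → ∃ A ∈ 𝒜, ¬ Decides V A) : HasTunnel K := by
  classical
  obtain ⟨A, hA⟩ := (h𝒜.insert ∅).exists_eq_range ⟨∅, Set.mem_insert _ _⟩
  have hAc : ∀ n, IsClopen (A n) := by
    intro n
    have : A n ∈ insert ∅ 𝒜 := hA ▸ ⟨n, rfl⟩
    rcases this with h | h
    · exact h ▸ isClopen_empty
    · exact hclopen _ h
  let g : K → ℕ → Bool := fun x n => (A n).boolIndicator x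
  have hg : Continuous g :=
    continuous_pi fun n => (continuous_boolIndicator_iff_isClopen _).2 (hAc n)
  refine hasTunnel_of_forall_exists_ne hz
    (f := fun x => (cantorSetHomeomorphNatToBool.symm (g x) : ℝ))
    (continuous_subtype_val.comp (cantorSetHomeomorphNatToBool.symm.continuous.comp hg)) ?_
  intro V hV hVne
  obtain ⟨B, hB, hVB⟩ := hnd V hV hVne
  obtain ⟨n, rfl⟩ : B ∈ Set.range A := hA ▸ Set.mem_insert_of_mem _ hB
  rw [Decides, not_or, Set.not_subset, Set.not_disjoint_iff] at hVB
  obtain ⟨⟨x, hx, hxA⟩, y, hy, hyA⟩ := hVB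
  refine ⟨x, hx, y, hy, fun h => ?_⟩
  have := congrFun (cantorSetHomeomorphNatToBool.symm.injective (Subtype.ext h)) n
  rw [show g x n = false from (Set.notMem_iff_boolIndicator _ _).1 hxA,
    show g y n = true from (Set.mem_iff_boolIndicator _ _).1 hyA] at this
  exact absurd this (by decide)

end Tunnel

/-! ### A Suslin tree of clopen sets -/

section ClopenTree

variable {K : Type*} [TopologicalSpace K]

/-- Every family of nonempty sets has a maximal disjoint subfamily, and each member of the family
meets a member of the subfamily. -/
theorem exists_maximal_pairwiseDisjoint {α : Type*} {D : Set (Set α)}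
    (hD : ∀ V ∈ D, V.Nonempty) :
    ∃ M ⊆ D, M.PairwiseDisjoint id ∧ ∀ V ∈ D, ∃ A ∈ M, ¬ Disjoint V A := by
  obtain ⟨M, hM⟩ := zorn_subset {M : Set (Set α) | M ⊆ D ∧ M.PairwiseDisjoint id} (by
    intro c hc hchain
    refine ⟨⋃₀ c, ⟨Set.sUnion_subset fun s hs => (hc hs).1, ?_⟩,
      fun s hs => Set.subset_sUnion_of_mem hs⟩
    exact (Set.pairwiseDisjoint_sUnion hchain.directedOn).2 fun s hs => (hc hs).2)
  refine ⟨M, hM.prop.1, hM.prop.2, fun V hV => ?_⟩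
  by_contra! h
  have hVM : V ∈ M := by
    refine hM.le_of_ge (y := insert V M) ⟨Set.insert_subset hV hM.prop.1, ?_⟩
      (Set.subset_insert _ _) (Set.mem_insert _ _)
    exact hM.prop.2.insert fun A hA _ => h A hA
  exact (hD V hV).ne_empty (disjoint_self.1 (h V hVM))

/-- Recursion along a well-order: a sequence of sets, each determined by the union of the earlier
ones. -/
theorem exists_eq_iUnion_lt {I α : Type*} [LinearOrder I] [WellFoundedLT I]
    (M : Set α → Set α) : ∃ P : I → Set α, ∀ i, P i = M (⋃ j : Set.Iio i, P j) := by
  refine ⟨wellFounded_lt.fix (r := ((· < ·) : I → I → Prop))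
    (fun i f => M (⋃ j : Set.Iio i, f j.1 j.2)), fun i => ?_⟩
  rw [WellFounded.fix_eq]

/-- Members of `𝒯` that are incomparable are disjoint, so antichains are countable. Chains are
countable because the differences of consecutive members are disjoint. The order dual makes larger
sets come first. -/
theorem isSuslinTree_of_clopen (hccc : IsCCC K) {𝒯 : Set (Set K)ᵒᵈ}
    (hclopen : ∀ V ∈ 𝒯, IsClopen (OrderDual.ofDual V))
    (hne : ∀ V ∈ 𝒯, (OrderDual.ofDual V).Nonempty)
    (htri : ∀ U ∈ 𝒯, ∀ V ∈ 𝒯, U ≤ V ∨ V ≤ U ∨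
      Disjoint (OrderDual.ofDual U) (OrderDual.ofDual V))
    (hmin : ∀ S ⊆ 𝒯, S.Nonempty → ∃ m ∈ S, ∀ x ∈ S, ¬ x < m) (hunc : ¬ 𝒯.Countable) :
    IsSuslinTree 𝒯 := by
  have hmin' : ∀ S : Set 𝒯, S.Nonempty → ∃ m ∈ S, ∀ x ∈ S, ¬ x < m := by
    intro S hS
    obtain ⟨_, ⟨m, hm, rfl⟩, h⟩ := hmin (Subtype.val '' S) (by simp) (hS.image _)
    exact ⟨m, hm, fun x hx hxm => h _ ⟨x, hx, rfl⟩ hxm⟩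
  have htri' : ∀ a b t : 𝒯, a ≤ t → b ≤ t → a ≤ b ∨ b ≤ a := by
    rintro ⟨a, ha⟩ ⟨b, hb⟩ ⟨t, ht⟩ hat hbt
    rcases htri a ha b hb with h | h | h
    · exact Or.inl h
    · exact Or.inr h
    · obtain ⟨x, hx⟩ := hne t ht
      exact absurd (hbt hx) (Set.disjoint_left.1 h (hat hx))
  refine ⟨isTree_of_exists_minimal hmin' htri', ?_, fun C hC => ?_, fun A hA => ?_⟩
  · rwa [← not_countable_iff, Set.countable_coe_iff]
  · -- The differences between consecutive members of the chain are disjoint.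
    have hnext : ∀ V ∈ {V ∈ C | ∃ U ∈ C, V < U}, ∃ U ∈ C, V < U ∧ ∀ U' ∈ C, V < U' → U ≤ U' := by
      rintro V ⟨-, U, hU, hVU⟩
      obtain ⟨m, ⟨hm, hVm⟩, h⟩ := hmin' {U | U ∈ C ∧ V < U} ⟨U, hU, hVU⟩
      refine ⟨m, hm, hVm, fun U' hU' hVU' => ?_⟩
      rcases hC.total hm hU' with h' | h'
      · exact h'
      · exact (h'.eq_of_not_lt (h U' ⟨hU', hVU'⟩)).ge
    choose! next hnC hlt hle using hnext
    let d : 𝒯 → Set K := fun V => OrderDual.ofDual V.1 \ OrderDual.ofDual (next V).1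
    have hdne : ∀ V ∈ {V ∈ C | ∃ U ∈ C, V < U}, (d V).Nonempty := fun V hV =>
      Set.nonempty_of_ssubset
        (show OrderDual.ofDual (next V).1 ⊂ OrderDual.ofDual V.1 from hlt V hV)
    have hdd : ∀ V ∈ {V ∈ C | ∃ U ∈ C, V < U}, ∀ V' ∈ {V ∈ C | ∃ U ∈ C, V < U}, V < V' →
        Disjoint (d V) (d V') := fun V hV V' hV' h =>
      Set.disjoint_left.2 fun x hx hx' => hx.2 (hle V hV V' hV'.1 h hx'.1)
    have hdd' : {V ∈ C | ∃ U ∈ C, V < U}.PairwiseDisjoint d := by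
      intro V hV V' hV' h
      rcases hC.total hV.1 hV'.1 with h' | h'
      · exact hdd V hV V' hV' (h'.lt_of_ne h)
      · exact (hdd V' hV' V hV (h'.lt_of_ne h.symm)).symm
    have hinj : Set.InjOn d {V ∈ C | ∃ U ∈ C, V < U} := by
      intro V hV V' hV' h
      by_contra hne'
      have h' : Disjoint (d V) (d V') := hdd' hV hV' hne'
      rw [← h, disjoint_self] at h'
      exact (hdne V hV).ne_empty h'
    have hcount : {V ∈ C | ∃ U ∈ C, V < U}.Countable := by
      refine Set.countable_of_injective_of_countable_image hinj (hccc _ ?_ ?_)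
      · rintro _ ⟨V, hV, rfl⟩
        exact ⟨(hclopen _ V.2).isOpen.sdiff (hclopen _ (next V).2).isClosed, hdne V hV⟩
      · rintro _ ⟨V, hV, rfl⟩ _ ⟨V', hV', rfl⟩ h
        exact hdd' hV hV' fun h' => h (congrArg d h')
    have hsub : {V ∈ C | ¬ ∃ U ∈ C, V < U}.Subsingleton := by
      rintro V ⟨hV, hVn⟩ V' ⟨hV', hVn'⟩
      by_contra h
      rcases hC.total hV hV' with h' | h'
      · exact hVn ⟨V', hV', h'.lt_of_ne h⟩
      · exact hVn' ⟨V, hV, h'.lt_of_ne (Ne.symm h)⟩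
    refine (hcount.union hsub.countable).mono fun V hV => ?_
    by_cases h : ∃ U ∈ C, V < U
    · exact Or.inl ⟨hV, h⟩
    · exact Or.inr ⟨hV, h⟩
  · have hinj : Function.Injective fun V : 𝒯 => OrderDual.ofDual V.1 :=
      OrderDual.ofDual.injective.comp Subtype.val_injective
    refine Set.countable_of_injective_of_countable_image hinj.injOn (s := A) (hccc _ ?_ ?_)
    · rintro _ ⟨V, hV, rfl⟩
      exact ⟨(hclopen _ V.2).isOpen, hne _ V.2⟩
    · rintro _ ⟨V, hV, rfl⟩ _ ⟨V', hV', rfl⟩ h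
      have hVV' : V ≠ V' := fun h' => h (by rw [h'])
      rcases htri _ V.2 _ V'.2 with h' | h' | h'
      · exact absurd h' (hA hV hV' hVV')
      · exact absurd h' (hA hV' hV hVV'.symm)
      · exact h'

/-- Suppose that the open sets deciding any given countable family of clopen sets are dense in `W`.
Iterating `ω₁` times, choose a maximal disjoint family of clopen sets deciding all the sets chosen
before. The result is a Suslin tree under reverse inclusion. -/
theorem exists_isSuslinTree_of_decides (hccc : IsCCC K) (hz : IsZeroDimensional K)
    (hiso : HasNoIsolatedPoints K) [T2Space K] {W : Set K} (hW : IsOpen W) (hWne : W.Nonempty)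
    (hdec : ∀ 𝒜 : Set (Set K), 𝒜.Countable → (∀ A ∈ 𝒜, IsClopen A) → ∀ O ⊆ W, IsOpen O →
      O.Nonempty → ∃ V ⊆ O, IsOpen V ∧ V.Nonempty ∧ ∀ A ∈ 𝒜, Decides V A) :
    ∃ (T : Type) (_ : PartialOrder T), IsSuslinTree T := by
  let D : Set (Set K) → Set (Set K) := fun 𝒜 =>
    {V | IsClopen V ∧ V.Nonempty ∧ V ⊆ W ∧ ∀ A ∈ 𝒜, V ⊂ A ∨ Disjoint V A}
  have hD : ∀ 𝒜 : Set (Set K), 𝒜.Countable → (∀ A ∈ 𝒜, IsClopen A) → (D 𝒜).Nonempty := by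
    intro 𝒜 h𝒜 hcl
    obtain ⟨V, hVW, hV, ⟨x, hx⟩, hVd⟩ := hdec 𝒜 h𝒜 hcl W subset_rfl hW hWne
    -- Shrinking `V` properly makes the inclusions strict.
    obtain ⟨y, hyV, hyx⟩ : ∃ y ∈ V, y ≠ x := by
      by_contra! h
      exact hiso x ((Set.eq_singleton_iff_unique_mem.2 ⟨hx, h⟩) ▸ hV)
    obtain ⟨U, hU, hxU, hUV⟩ := hz.exists_subset_of_mem_open (u := V \ {y}) ⟨hx, hyx.symm⟩
      (hV.sdiff isClosed_singleton)
    have hUV' : U ⊆ V := fun z hz' => (hUV hz').1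
    refine ⟨U, hU, ⟨x, hxU⟩, hUV'.trans hVW, fun A hA => ?_⟩
    rcases hVd A hA with h | h
    · exact Or.inl ⟨hUV'.trans h, fun h' => (hUV (h' (h hyV))).2 rfl⟩
    · exact Or.inr (h.mono_left hUV')
  have hmax : ∀ 𝒜, ∃ M ⊆ D 𝒜, M.PairwiseDisjoint id ∧ ∀ V ∈ D 𝒜, ∃ A ∈ M, ¬ Disjoint V A :=
    fun 𝒜 => exists_maximal_pairwiseDisjoint fun V hV => hV.2.1
  choose M hMD hMdisj hMmax using hmax
  have hMc : ∀ 𝒜, (M 𝒜).Countable := fun 𝒜 =>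
    hccc _ (fun V hV => ⟨(hMD 𝒜 hV).1.isOpen, (hMD 𝒜 hV).2.1⟩) (hMdisj 𝒜)
  let I := (Cardinal.aleph 1 : Cardinal.{0}).ord.ToType
  have hI : ∀ i : I, Countable (Set.Iio i) := fun i => by
    have h : Cardinal.mk (Set.Iio i) < Cardinal.aleph 1 :=
      (Cardinal.mk_Iio_lt i (by simp [I])).trans_eq (by simp [I])
    rw [← Cardinal.mk_le_aleph0_iff, ← Order.lt_succ_iff, Cardinal.succ_aleph0]
    exact h
  obtain ⟨P, hP⟩ := exists_eq_iUnion_lt (I := I) M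
  have hPD : ∀ i, P i ⊆ D (⋃ j : Set.Iio i, P j) := fun i => by
    conv_lhs => rw [hP i]
    exact hMD _
  have hPdisj : ∀ i, (P i).PairwiseDisjoint id := fun i => by rw [hP i]; exact hMdisj _
  have hPc : ∀ i, (P i).Countable := fun i => by rw [hP i]; exact hMc _
  have hPne : ∀ i, (P i).Nonempty := fun i => by
    obtain ⟨V, hV⟩ := hD (⋃ j : Set.Iio i, P j) (Set.countable_iUnion fun j => hPc j) (by
      intro A hA
      obtain ⟨j, hj⟩ := Set.mem_iUnion.1 hA
      exact (hPD j hj).1)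
    obtain ⟨A, hA, -⟩ := hMmax _ V hV
    rw [hP i]
    exact ⟨A, hA⟩
  have hlt : ∀ i j, j < i → ∀ V ∈ P i, ∀ A ∈ P j, V ⊂ A ∨ Disjoint V A := fun i j hij V hV A hA =>
    (hPD i hV).2.2.2 A (Set.mem_iUnion.2 ⟨⟨j, hij⟩, hA⟩)
  have hnevP : ∀ i, ∀ V ∈ P i, V.Nonempty := fun i V hV => (hPD i hV).2.1
  let 𝒯 : Set (Set K)ᵒᵈ := ⋃ i : I, OrderDual.ofDual ⁻¹' P i
  have hT : IsSuslinTree 𝒯 := by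
    refine isSuslinTree_of_clopen hccc ?_ ?_ ?_ ?_ ?_
    · intro V hV
      obtain ⟨i, hi⟩ := Set.mem_iUnion.1 hV
      exact (hPD i hi).1
    · intro V hV
      obtain ⟨i, hi⟩ := Set.mem_iUnion.1 hV
      exact hnevP i _ hi
    · intro U hU V hV
      obtain ⟨i, hi⟩ := Set.mem_iUnion.1 hU
      obtain ⟨j, hj⟩ := Set.mem_iUnion.1 hV
      rcases lt_trichotomy i j with h | rfl | h
      · rcases hlt j i h _ hj _ hi with h | h
        · exact Or.inl h.subset
        · exact Or.inr (Or.inr h.symm)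
      · by_cases h : U = V
        · exact Or.inl h.le
        · exact Or.inr (Or.inr (hPdisj i hi hj h))
      · rcases hlt i j h _ hi _ hj with h | h
        · exact Or.inr (Or.inl h.subset)
        · exact Or.inr (Or.inr h)
    · rintro S hS ⟨V, hV⟩
      obtain ⟨i₀, hi₀⟩ := Set.mem_iUnion.1 (hS hV)
      obtain ⟨i, ⟨U, hU, hUi⟩, hi⟩ := (wellFounded_lt (α := I)).has_min
        {i | ∃ U ∈ S, OrderDual.ofDual U ∈ P i} ⟨i₀, V, hV, hi₀⟩
      refine ⟨U, hU, fun U' hU' hlt' => ?_⟩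
      obtain ⟨j, hj⟩ := Set.mem_iUnion.1 (hS hU')
      have hss : OrderDual.ofDual U ⊂ OrderDual.ofDual U' := hlt'
      obtain ⟨x, hx⟩ := hnevP i _ hUi
      rcases (not_lt.1 (hi j ⟨U', hU', hj⟩)).eq_or_lt with rfl | hij
      · exact Set.disjoint_left.1 (hPdisj i hUi hj hss.ne) hx (hss.subset hx)
      · rcases hlt j i hij _ hj _ hUi with h | h
        · exact h.not_subset hss.subset
        · exact Set.disjoint_left.1 h (hss.subset hx) hx
    · intro hcount
      choose V hV using hPne
      have hinj : Function.Injective V := by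
        have hVne : ∀ i j, j < i → V i ≠ V j := fun i j hij heq => by
          rcases hlt i j hij _ (hV i) _ (hV j) with h | h
          · exact h.ne heq
          · rw [heq] at h
            exact (hnevP j _ (hV j)).ne_empty (disjoint_self.1 h)
        intro i j h
        rcases lt_trichotomy i j with hij | hij | hij
        · exact absurd h.symm (hVne j i hij)
        · exact hij
        · exact absurd h (hVne i j hij)
      have h1 : (Set.univ : Set I).Countable := by
        refine (hcount.preimage_of_injOn
          (f := fun i => OrderDual.toDual (V i)) fun i _ j _ h => hinj h).mono fun i _ => ?_
        exact Set.mem_iUnion.2 ⟨i, hV i⟩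
      have h2 : Countable I := Set.countable_univ_iff.1 h1
      rw [← Cardinal.mk_le_aleph0_iff, Cardinal.mk_toType, Cardinal.card_ord] at h2
      exact absurd Cardinal.aleph0_lt_aleph_one (not_lt.2 h2)
  have : ∀ i, Countable (OrderDual.ofDual ⁻¹' P i) := fun i =>
    ((hPc i).preimage OrderDual.ofDual.injective).to_subtype
  have hsmall : Small.{0} 𝒯 := small_iUnion _
  let e : Shrink.{0} 𝒯 ≃ 𝒯 := (equivShrink 𝒯).symm
  let _ : PartialOrder (Shrink.{0} 𝒯) := PartialOrder.lift e e.injective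
  exact ⟨_, _, hT.of_orderIso ⟨e, Iff.rfl⟩⟩

/-- Either one countable family of clopen sets is decided by no nonempty open set, which gives a
tunnel, or the sets deciding any countable family are dense in some open set. -/
theorem SuslinHypothesis.hasTunnel (hSH : SuslinHypothesis) [T2Space K] [CompactSpace K]
    (hccc : IsCCC K) (hz : IsZeroDimensional K) (hiso : HasNoIsolatedPoints K) : HasTunnel K := by
  let Bad : Set K → Set (Set K) → Prop := fun W 𝒜 => 𝒜.Countable ∧ (∀ A ∈ 𝒜, IsClopen A) ∧
    ∀ V ⊆ W, IsOpen V → V.Nonempty → ∃ A ∈ 𝒜, ¬ Decides V A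
  let D : Set (Set K) := {W | IsOpen W ∧ W.Nonempty ∧ ∃ 𝒜, Bad W 𝒜}
  obtain ⟨M, hMD, hMdisj, hMmax⟩ := exists_maximal_pairwiseDisjoint (D := D) fun W hW => hW.2.1
  have hMc : M.Countable := hccc M (fun W hW => ⟨(hMD hW).1, (hMD hW).2.1⟩) hMdisj
  have hbad : ∀ W ∈ M, ∃ 𝒜, Bad W 𝒜 := fun W hW => (hMD hW).2.2
  choose! 𝒜 h𝒜c h𝒜cl h𝒜 using hbad
  refine hasTunnel_of_not_decides hz (𝒜 := ⋃ W ∈ M, 𝒜 W) (hMc.biUnion h𝒜c) ?_ ?_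
  · intro A hA
    obtain ⟨W, hW, hAW⟩ := Set.mem_iUnion₂.1 hA
    exact h𝒜cl W hW A hAW
  · intro V hV hVne
    by_cases hVD : ∃ O ⊆ V, O ∈ D
    · obtain ⟨O, hOV, hO⟩ := hVD
      obtain ⟨W, hW, hOW⟩ := hMmax O hO
      obtain ⟨A, hA, hnd⟩ := h𝒜 W hW (O ∩ W) Set.inter_subset_right (hO.1.inter (hMD hW).1)
        (Set.not_disjoint_iff_nonempty_inter.1 hOW)
      have hsub : O ∩ W ⊆ V := Set.inter_subset_left.trans hOV
      exact ⟨A, Set.mem_biUnion hW hA,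
        fun h => hnd (h.imp hsub.trans fun h => h.mono_left hsub)⟩
    · exfalso
      obtain ⟨T, _, hT⟩ := exists_isSuslinTree_of_decides hccc hz hiso hV hVne (by
        intro ℬ hℬ hcl O hOV hO hOne
        by_contra! h
        exact hVD ⟨O, hOV, hO, hOne, ℬ, hℬ, hcl, h⟩)
      exact hSH T hT

end ClopenTree

/-! ### Suslin trees -/

section SuslinTree

variable {T : Type*} [PartialOrder T]

theorem IsSuslinTree.countable_Iic (hT : IsSuslinTree T) (t : T) : (Set.Iic t).Countable :=
  hT.countable_of_isChain _ fun _ ha _ hb _ => hT.isTree.le_or_le ha hb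

/-- The minimal elements of the set in question form an antichain, and the set is the union of the
cones above them. -/
theorem IsSuslinTree.countable_setOf_countable_Ici (hT : IsSuslinTree T) :
    {t : T | (Set.Ici t).Countable}.Countable := by
  let B := {t : T | (Set.Ici t).Countable}
  let M := {m ∈ B | ∀ x ∈ B, ¬ x < m}
  have hM : M.Countable := hT.countable_of_isAntichain _ fun a ha b hb hab h =>
    hb.2 a ha.1 (h.lt_of_ne hab)
  refine (hM.biUnion fun m hm => show (Set.Ici m).Countable from hm.1).mono fun t ht => ?_
  obtain ⟨m, ⟨hmB, hmt⟩, hmin⟩ :=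
    hT.isTree.exists_minimal (S := {x | x ∈ B ∧ x ≤ t}) ⟨t, ht, le_rfl⟩
  exact Set.mem_biUnion (x := m) ⟨hmB, fun x hx hxm => hmin x ⟨hx, hxm.le.trans hmt⟩ hxm⟩ hmt

/-- A pressing-down lemma: a regressive function on a co-countable set has an uncountable fibre.
Otherwise the countable set of those elements from which finitely many applications of `f` lead to
the complement of `B` would be everything. -/
theorem IsSuslinTree.exists_not_countable_fiber (hT : IsSuslinTree T) {B : Set T}
    (hB : Bᶜ.Countable) {f : T → T} (hf : ∀ t ∈ B, f t < t) :
    ∃ s, ¬ {t ∈ B | f t = s}.Countable := by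
  by_contra! h
  let S : ℕ → Set T := fun n => Nat.rec Bᶜ (fun _ A => ⋃ s ∈ A, {t ∈ B | f t = s}) n
  have hS : ∀ n, (S n).Countable := by
    intro n
    induction n with
    | zero => exact hB
    | succ n ih => exact ih.biUnion fun s _ => h s
  have huniv : ⋃ n, S n = Set.univ := by
    by_contra hne
    obtain ⟨t, ht, hmin⟩ := hT.isTree.exists_minimal (S := (⋃ n, S n)ᶜ)
      (Set.nonempty_compl.2 hne)
    have htB : t ∈ B := by
      by_contra htB
      exact ht (Set.mem_iUnion.2 ⟨0, htB⟩)
    obtain ⟨n, hn⟩ := Set.mem_iUnion.1 (not_not.1 fun hft => hmin (f t) hft (hf t htB))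
    exact ht (Set.mem_iUnion.2 ⟨n + 1, Set.mem_biUnion hn ⟨htB, rfl⟩⟩)
  have hc := Set.countable_iUnion hS
  rw [huniv, Set.countable_univ_iff] at hc
  exact not_countable_iff.2 hT.uncountable hc

/-- If the sets of predecessors formed a chain, its union `C` would be countable. For `t ∈ A`, the
predecessors of `t` are then either all of `C` or those of an element of `C`, and the elements
with given predecessors form an antichain. -/
theorem IsSuslinTree.exists_not_Iio_subset (hT : IsSuslinTree T) {A : Set T} (hA : ¬ A.Countable) :
    ∃ t ∈ A, ∃ t' ∈ A, ¬ Set.Iio t ⊆ Set.Iio t' ∧ ¬ Set.Iio t' ⊆ Set.Iio t := by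
  by_contra! h
  apply hA
  let C := ⋃ t ∈ A, Set.Iio t
  have hC : C.Countable := by
    refine hT.countable_of_isChain _ fun a ha b hb _ => ?_
    obtain ⟨t, ht, hat⟩ := Set.mem_iUnion₂.1 ha
    obtain ⟨t', ht', hbt⟩ := Set.mem_iUnion₂.1 hb
    by_cases hs : Set.Iio t ⊆ Set.Iio t'
    · exact hT.isTree.le_or_le (hs hat).le (le_of_lt hbt)
    · exact hT.isTree.le_or_le (le_of_lt hat) (h t ht t' ht' hs hbt).le
  have hanti : ∀ P : Set T, {t | Set.Iio t = P}.Countable := fun P =>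
    hT.countable_of_isAntichain _ fun a ha b hb hab hle => by
      have : a ∈ Set.Iio b := hle.lt_of_ne hab
      rw [show Set.Iio b = Set.Iio a from hb.trans ha.symm] at this
      exact lt_irrefl a this
  refine ((hanti C).union (hC.biUnion fun c _ => hanti (Set.Iio c))).mono fun t ht => ?_
  have htC : Set.Iio t ⊆ C := fun x hx => Set.mem_biUnion ht hx
  by_cases hCt : C ⊆ Set.Iio t
  · exact Or.inl (htC.antisymm hCt)
  · right
    obtain ⟨c, ⟨hc, hct⟩, hmin⟩ := hT.isTree.exists_minimal (S := C \ Set.Iio t)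
      (Set.sdiff_nonempty.2 hCt)
    refine Set.mem_biUnion hc (Set.Subset.antisymm (fun x hx => ?_) fun x hx => ?_)
    · obtain ⟨t', ht', hct'⟩ := Set.mem_iUnion₂.1 hc
      have hxt' : x < t' := by
        by_contra hxt'
        exact hct (h t ht t' ht' (fun hs => hxt' (hs hx)) hct')
      rcases hT.isTree.le_or_le hxt'.le (le_of_lt hct') with hxc | hcx
      · exact hxc.lt_of_ne fun he => hct (he ▸ hx)
      · exact absurd (hcx.trans_lt hx) hct
    · obtain ⟨t', ht', hct'⟩ := Set.mem_iUnion₂.1 hc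
      by_contra hxt
      exact hmin x ⟨Set.mem_biUnion ht' (lt_trans hx hct'), hxt⟩ hx

end SuslinTree

/-! ### The path space of a Suslin tree -/

section PathSpace

variable {T : Type*} [PartialOrder T]

open Classical in
/-- The characteristic function of the initial segment of elements `≤ t`. -/
noncomputable def segment (t : T) : T → Bool := fun s => decide (s ≤ t)

variable (T) in
/-- The space of those paths through `T` (coded by their characteristic functions) every
neighbourhood of which contains the initial segments `segment t` of uncountably many `t`. -/
def pathSpace : Set (T → Bool) :=
  {y | ∀ O : Set (T → Bool), IsOpen O → y ∈ O → ¬ (segment ⁻¹' O).Countable}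

/-- The paths through `t`. -/
def cone (t : T) : Set (pathSpace T) :=
  {q | q.1 t = true}

theorem isClosed_pathSpace : IsClosed (pathSpace T) := by
  refine isOpen_compl_iff.1 (isOpen_iff_forall_mem_open.2 fun y hy => ?_)
  simp only [pathSpace, Set.mem_compl_iff, Set.mem_ofPred_eq, not_forall, not_not] at hy
  obtain ⟨O, hO, hyO, hc⟩ := hy
  exact ⟨O, fun z hz hz' => hz' O hO hz hc, hO, hyO⟩

instance : CompactSpace (pathSpace T) :=
  isCompact_iff_compactSpace.1 isClosed_pathSpace.isCompact

theorem countable_preimage_segment {C : Set (T → Bool)} (hC : IsClosed C)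
    (hd : Disjoint C (pathSpace T)) : (segment ⁻¹' C).Countable := by
  refine hC.isCompact.induction_on (p := fun S => (segment ⁻¹' S).Countable) (by simp)
    (fun s t hst ht => ht.mono (Set.preimage_mono hst)) (fun s t hs ht => ?_) fun y hy => ?_
  · rw [Set.preimage_union]
    exact hs.union ht
  · have := Set.disjoint_left.1 hd hy
    simp only [pathSpace, Set.mem_ofPred_eq, not_forall, not_not] at this
    obtain ⟨O, hO, hyO, hc⟩ := this
    exact ⟨O, mem_nhdsWithin_of_mem_nhds (hO.mem_nhds hyO), hc⟩

theorem pathSpace_subset {C : Set (T → Bool)} (hC : IsClosed C) (h : ∀ t, segment t ∈ C) :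
    pathSpace T ⊆ C := by
  intro y hy
  by_contra hyC
  refine hy Cᶜ hC.isOpen_compl hyC ?_
  convert Set.countable_empty
  exact Set.eq_empty_of_forall_notMem fun t ht => ht (h t)

theorem isClopen_setOf_apply {ι : Type*} (t : ι) (b : Bool) : IsClopen {y : ι → Bool | y t = b} :=
  (isClopen_discrete {b}).preimage (continuous_apply t)

theorem isClopen_cone (t : T) : IsClopen (cone t) :=
  (isClopen_setOf_apply t true).preimage continuous_subtype_val

theorem apply_of_le (q : pathSpace T) {s t : T} (hst : s ≤ t) (ht : q.1 t = true) :
    q.1 s = true := by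
  have := pathSpace_subset (C := {y | y t = false} ∪ {y | y s = true})
    ((isClopen_setOf_apply t _).isClosed.union (isClopen_setOf_apply s _).isClosed) (fun r => by
      by_cases h : t ≤ r
      · exact Or.inr (by simpa [segment] using hst.trans h)
      · exact Or.inl (by simpa [segment] using h)) q.2
  rcases this with h | h
  · exact absurd (ht.symm.trans h) (by decide)
  · exact h

theorem le_or_le_of_apply (hT : IsTree T) (q : pathSpace T) {s t : T} (hs : q.1 s = true)
    (ht : q.1 t = true) : s ≤ t ∨ t ≤ s := by
  by_contra hn
  have := pathSpace_subset (C := {y | y t = false} ∪ {y | y s = false})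
    ((isClopen_setOf_apply t _).isClosed.union (isClopen_setOf_apply s _).isClosed) (fun r => by
      by_cases h : t ≤ r
      · refine Or.inr ?_
        have : ¬ s ≤ r := fun h' => hn (hT.le_or_le h' h)
        simpa [segment] using this
      · exact Or.inl (by simpa [segment] using h)) q.2
  rcases this with h | h
  · exact absurd (ht.symm.trans h) (by decide)
  · exact absurd (hs.symm.trans h) (by decide)

theorem cone_nonempty {t : T} (ht : ¬ (Set.Ici t).Countable) : (cone t).Nonempty := by
  by_contra h
  refine ht ((countable_preimage_segment (isClopen_setOf_apply t true).isClosed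
    (Set.disjoint_left.2 fun y hy hyK => h ⟨⟨y, hyK⟩, hy⟩)).mono fun r hr => ?_)
  simpa [segment] using hr

theorem exists_finset_of_isOpen {ι : Type*} {O : Set (ι → Bool)} (hO : IsOpen O) {y : ι → Bool}
    (hy : y ∈ O) : ∃ G : Finset ι, ∀ z, (∀ g ∈ G, z g = y g) → z ∈ O := by
  obtain ⟨G, u, hu, hsub⟩ := isOpen_pi_iff.1 hO y hy
  exact ⟨G, fun z hz => hsub fun g hg => (hz g hg).symm ▸ (hu g hg).2⟩

/-- The cones over elements with uncountably many successors form a `π`-base. -/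
theorem exists_cone_subset (hT : IsSuslinTree T) {U : Set (pathSpace T)} (hU : IsOpen U)
    (hne : U.Nonempty) : ∃ t, ¬ (Set.Ici t).Countable ∧ cone t ⊆ U := by
  obtain ⟨y, hy⟩ := hne
  obtain ⟨O, hO, rfl⟩ := isOpen_induced_iff.1 hU
  obtain ⟨G, hG⟩ := exists_finset_of_isOpen hO hy
  have hOG : IsOpen {z : T → Bool | ∀ g ∈ G, z g = y.1 g} := by
    have : {z : T → Bool | ∀ g ∈ G, z g = y.1 g} = ⋂ g ∈ G, {z | z g = y.1 g} := by
      ext; simp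
    rw [this]
    exact isOpen_biInter_finset fun g _ => (isClopen_setOf_apply g _).isOpen
  have hunc := y.2 _ hOG fun g _ => rfl
  obtain ⟨t, htG, ht⟩ := Set.not_subset.1 fun hsub => hunc
    ((hT.countable_setOf_countable_Ici.union
      (G.countable_toSet.biUnion fun g _ => hT.countable_Iic g)).mono hsub)
  rw [Set.mem_union, not_or] at ht
  refine ⟨t, ht.1, fun q hq => hG _ fun g hg => ?_⟩
  have hgt : segment t g = y.1 g := htG g hg
  rw [← hgt]
  by_cases h : g ≤ t
  · simpa [segment, h] using apply_of_le q h hq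
  · have : ¬ q.1 g = true := fun hqg => by
      rcases le_or_le_of_apply hT.isTree q hqg hq with h' | h'
      · exact h h'
      · exact ht.2 (Set.mem_biUnion hg h')
    simpa [segment, h] using this

/-- Choosing a cone inside each of a family of disjoint open sets gives an antichain of `T`. -/
theorem isCCC_pathSpace (hT : IsSuslinTree T) : IsCCC (pathSpace T) := by
  intro 𝒰 h𝒰 hdisj
  have hsub : ∀ U ∈ 𝒰, ∃ t, ¬ (Set.Ici t).Countable ∧ cone t ⊆ U := fun U hU =>
    exists_cone_subset hT (h𝒰 U hU).1 (h𝒰 U hU).2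
  have : Nonempty T := by
    have := hT.uncountable
    infer_instance
  choose! r hr hrU using hsub
  have hle : ∀ U ∈ 𝒰, ∀ V ∈ 𝒰, r U ≤ r V → U = V := by
    intro U hU V hV h
    by_contra hne
    obtain ⟨q, hq⟩ := cone_nonempty (hr V hV)
    exact Set.disjoint_left.1 (hdisj hU hV hne) (hrU U hU (apply_of_le q h hq)) (hrU V hV hq)
  refine Set.countable_of_injective_of_countable_image (f := r)
    (fun U hU V hV h => hle U hU V hV h.le) (hT.countable_of_isAntichain _ ?_)
  rintro _ ⟨U, hU, rfl⟩ _ ⟨V, hV, rfl⟩ hne h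
  exact hne (congrArg r (hle U hU V hV h))

/-- If `x` were isolated, some cone would be `{x}`, and all but countably many elements above its
vertex would lie on the countable chain `x`. -/
theorem hasNoIsolatedPoints_pathSpace (hT : IsSuslinTree T) :
    HasNoIsolatedPoints (pathSpace T) := by
  intro x hx
  obtain ⟨t, ht, hsub⟩ := exists_cone_subset hT hx ⟨x, rfl⟩
  have hchain : {r | x.1 r = true}.Countable := hT.countable_of_isChain _ fun a ha b hb _ =>
    le_or_le_of_apply hT.isTree x ha hb
  refine ht ((hchain.union hT.countable_setOf_countable_Ici).mono fun r hr => ?_)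
  by_cases h : (Set.Ici r).Countable
  · exact Or.inr h
  · obtain ⟨q, hq⟩ := cone_nonempty h
    have hqx : q = x := hsub (apply_of_le q hr hq)
    exact Or.inl (hqx ▸ hq)

theorem isZeroDimensional_pathSpace : IsZeroDimensional (pathSpace T) :=
  loc_compact_Haus_tot_disc_of_zero_dim

/-! ### The path space has no tunnel -/

open Classical in
/-- A neighbourhood of the path of all predecessors of `t` contains, above some `s < t`, all paths
that branch off below `t`. -/
theorem exists_lt_forall_mem_of_isOpen (hT : IsTree T) {t : T} (ht : (Set.Iio t).Nonempty)
    {O : Set (T → Bool)} (hO : IsOpen O) (htO : (fun s => decide (s < t)) ∈ O) :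
    ∃ s < t, ∀ q ∈ cone s, (¬ ∀ r < t, q.1 r = true) → q.1 ∈ O := by
  obtain ⟨G, hG⟩ := exists_finset_of_isOpen hO htO
  suffices h : ∃ s < t, ∀ q ∈ cone s, (¬ ∀ r < t, q.1 r = true) →
      ∀ g ∈ G, q.1 g = decide (g < t) by
    obtain ⟨s, hs, h⟩ := h
    exact ⟨s, hs, fun q hq hqt => hG _ (h q hq hqt)⟩
  clear hG
  induction G using Finset.induction_on with
  | empty =>
    obtain ⟨s, hs⟩ := ht
    exact ⟨s, hs, by simp⟩
  | insert g G _ ih =>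
    obtain ⟨s₁, hs₁, h₁⟩ := ih
    obtain ⟨s₂, hs₂, h₂⟩ : ∃ s < t, ∀ q ∈ cone s, (¬ ∀ r < t, q.1 r = true) →
        q.1 g = decide (g < t) := by
      by_cases hg : g < t
      · exact ⟨g, hg, fun q hq _ => hq.trans (decide_eq_true hg).symm⟩
      · by_cases hall : ∀ r < t, r ≤ g
        · refine ⟨s₁, hs₁, fun q _ hqt => ?_⟩
          have : ¬ q.1 g = true := fun hqg => hqt fun r hr => apply_of_le q (hall r hr) hqg
          simpa [hg] using this
        · push Not at hall
          obtain ⟨s, hs, hsg⟩ := hall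
          refine ⟨s, hs, fun q hq _ => ?_⟩
          have : ¬ q.1 g = true := fun hqg => by
            rcases le_or_le_of_apply hT q hqg hq with h | h
            · exact hg (h.trans_lt hs)
            · exact hsg h
          simpa [hg] using this
    have key : ∀ s, s₁ ≤ s → s₂ ≤ s → s < t → ∃ s < t, ∀ q ∈ cone s,
        (¬ ∀ r < t, q.1 r = true) → ∀ g' ∈ insert g G, q.1 g' = decide (g' < t) := by
      refine fun s h1 h2 hs => ⟨s, hs, fun q hq hqt => ?_⟩
      rw [Finset.forall_mem_insert]
      exact ⟨h₂ q (apply_of_le q h2 hq) hqt, h₁ q (apply_of_le q h1 hq) hqt⟩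
    rcases hT.le_or_le hs₁.le hs₂.le with h | h
    · exact key s₂ h le_rfl hs₂
    · exact key s₁ le_rfl h hs₁

theorem IsOpenChain.disjoint_frontier {K : Type*} [TopologicalSpace K] {𝒰 : Set (Set K)}
    (h : IsOpenChain 𝒰) {U V : Set K} (hU : U ∈ 𝒰) (hV : V ∈ 𝒰) (hne : U ≠ V) :
    Disjoint (frontier U) (frontier V) := by
  have key : ∀ A ∈ 𝒰, ∀ B ∈ 𝒰, A ≠ B → ClosureLE A B → Disjoint (frontier A) (frontier B) := by
    intro A _ B hB hAB hle
    refine Set.disjoint_left.2 fun x hxA hxB => ?_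
    rw [(h.1 B hB).frontier_eq] at hxB
    exact hxB.2 (hle.resolve_right hAB (frontier_subset_closure hxA))
  rcases h.2 U hU V hV with h' | h'
  · exact key U hU V hV hne h'
  · exact (key V hV U hU hne.symm h').symm

/-- As the boundaries are disjoint and nowhere dense, some `U ∈ 𝒰` splits the cone of `t` without
having the path of all predecessors of `t` on its boundary. Near that path, `U` is then all or
nothing. -/
theorem IsTunnel.exists_lt_forall_mem (hT : IsTree T) {𝒰 : Set (Set (pathSpace T))}
    (h𝒰 : IsTunnel 𝒰) {t : T} (ht : (Set.Iio t).Nonempty) (hunc : ¬ (Set.Ici t).Countable) :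
    ∃ s < t, ∃ U ∈ 𝒰, (frontier U ∩ cone t).Nonempty ∧
      ((∀ q ∈ cone s, (¬ ∀ r < t, q.1 r = true) → q ∈ U) ∨
        ∀ q ∈ cone s, (¬ ∀ r < t, q.1 r = true) → q ∉ U) := by
  classical
  have hmeet : ∀ V : Set (pathSpace T), IsOpen V → V.Nonempty →
      ∃ U ∈ 𝒰, (frontier U ∩ V).Nonempty := by
    intro V hV hVne
    obtain ⟨x, hxV, hx⟩ := h𝒰.2.inter_open_nonempty V hV hVne
    obtain ⟨U, hU, hxU⟩ := Set.mem_iUnion₂.1 hx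
    exact ⟨U, hU, x, hxU, hxV⟩
  by_cases hp : (fun s => decide (s < t)) ∈ pathSpace T
  · let p : pathSpace T := ⟨_, hp⟩
    obtain ⟨U, hU, hUt, hpU⟩ : ∃ U ∈ 𝒰, (frontier U ∩ cone t).Nonempty ∧ p ∉ frontier U := by
      by_cases hex : ∃ U₀ ∈ 𝒰, p ∈ frontier U₀
      · obtain ⟨U₀, hU₀, hpU₀⟩ := hex
        have hne : (cone t \ frontier U₀).Nonempty := by
          by_contra hemp
          rw [Set.not_nonempty_iff_eq_empty, Set.sdiff_eq_empty] at hemp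
          obtain ⟨q, hq⟩ := cone_nonempty hunc
          obtain ⟨z, hz, hzU⟩ := mem_closure_iff.1 (frontier_subset_closure (hemp hq)) _
            (isClopen_cone t).isOpen hq
          have := hemp hz
          rw [(h𝒰.1.1 U₀ hU₀).frontier_eq] at this
          exact this.2 hzU
        obtain ⟨U, hU, x, hxU, hxt, hxU₀⟩ := hmeet _
          ((isClopen_cone t).isOpen.sdiff isClosed_frontier) hne
        refine ⟨U, hU, ⟨x, hxU, hxt⟩, fun hpU => ?_⟩
        have hUU₀ : U ≠ U₀ := by
          rintro rfl
          exact hxU₀ hxU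
        exact Set.disjoint_left.1 (h𝒰.1.disjoint_frontier hU hU₀ hUU₀) hpU hpU₀
      · push Not at hex
        obtain ⟨U, hU, h⟩ := hmeet _ (isClopen_cone t).isOpen (cone_nonempty hunc)
        exact ⟨U, hU, h, hex U hU⟩
    have hUo := h𝒰.1.1 U hU
    by_cases hpU' : p ∈ U
    · obtain ⟨O, hO, hOU⟩ := isOpen_induced_iff.1 hUo
      obtain ⟨s, hs, h⟩ := exists_lt_forall_mem_of_isOpen hT ht hO
        (show p ∈ Subtype.val ⁻¹' O from hOU ▸ hpU')
      exact ⟨s, hs, U, hU, hUt, Or.inl fun q hq hqt => hOU ▸ h q hq hqt⟩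
    · have hpc : p ∈ (closure U)ᶜ := fun hpc => hpU (hUo.frontier_eq ▸ ⟨hpc, hpU'⟩)
      obtain ⟨O, hO, hOU⟩ := isOpen_induced_iff.1 (isClosed_closure (s := U)).isOpen_compl
      obtain ⟨s, hs, h⟩ := exists_lt_forall_mem_of_isOpen hT ht hO
        (show p ∈ Subtype.val ⁻¹' O from hOU ▸ hpc)
      refine ⟨s, hs, U, hU, hUt, Or.inr fun q hq hqt hqU => ?_⟩
      have : q ∈ Subtype.val ⁻¹' O := h q hq hqt
      rw [hOU] at this
      exact this (subset_closure hqU)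
  · -- No point of the path space branches off between `s` and `t`, so any `U` will do.
    obtain ⟨s, hs, h⟩ := exists_lt_forall_mem_of_isOpen hT ht
      isClosed_pathSpace.isOpen_compl hp
    obtain ⟨U, hU, hUt⟩ := hmeet _ (isClopen_cone t).isOpen (cone_nonempty hunc)
    exact ⟨s, hs, U, hU, hUt, Or.inl fun q hq hqt => absurd q.2 (h q hq hqt)⟩

theorem not_forall_lt_apply (hT : IsTree T) {t t' : T} (h : ¬ Set.Iio t ⊆ Set.Iio t')
    (h' : ¬ Set.Iio t' ⊆ Set.Iio t) {q : pathSpace T} (hq : q ∈ cone t') :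
    ¬ ∀ r < t, q.1 r = true := by
  intro hall
  obtain ⟨a, hat, hat'⟩ := Set.not_subset.1 h
  have htt' : ¬ t' ≤ t := fun hle => h' (Set.Iio_subset_Iio hle)
  rcases le_or_le_of_apply hT q (hall a hat) hq with hle | hle
  · rcases hle.eq_or_lt with rfl | hlt
    · exact htt' (le_of_lt hat)
    · exact hat' hlt
  · exact htt' (hle.trans (le_of_lt hat))

/-- Pressing down the bounds `s < t` gives `t`, `t'` with the same `s` and with incomparable sets of
predecessors. Of the sets `U`, `U'` that split the cones of `t`, `t'`, each contains all of the other
cone, or each contains none of it, which makes them incomparable in the tunnel. -/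
theorem not_hasTunnel_pathSpace (hT : IsSuslinTree T) : ¬ HasTunnel (pathSpace T) := by
  rintro ⟨𝒰, h𝒰⟩
  let B : Set T := {t | (Set.Iio t).Nonempty ∧ ¬ (Set.Ici t).Countable}
  have hB : Bᶜ.Countable := by
    have hroot : {t : T | ¬ (Set.Iio t).Nonempty}.Countable :=
      hT.countable_of_isAntichain _ fun a _ b hb hab hle => hb ⟨a, hle.lt_of_ne hab⟩
    refine (hroot.union hT.countable_setOf_countable_Ici).mono fun t ht => ?_
    by_cases h : (Set.Iio t).Nonempty
    · exact Or.inr (not_not.1 fun h' => ht ⟨h, h'⟩)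
    · exact Or.inl h
  have hex : ∀ t ∈ B, ∃ s < t, ∃ U ∈ 𝒰, (frontier U ∩ cone t).Nonempty ∧
      ((∀ q ∈ cone s, (¬ ∀ r < t, q.1 r = true) → q ∈ U) ∨
        ∀ q ∈ cone s, (¬ ∀ r < t, q.1 r = true) → q ∉ U) :=
    fun t ht => h𝒰.exists_lt_forall_mem hT.isTree ht.1 ht.2
  choose! f hf U hU hUt hUf using hex
  obtain ⟨s, hs⟩ := hT.exists_not_countable_fiber hB hf
  let A₁ := {t | (t ∈ B ∧ f t = s) ∧ ∀ q ∈ cone s, (¬ ∀ r < t, q.1 r = true) → q ∈ U t}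
  let A₂ := {t | (t ∈ B ∧ f t = s) ∧ ∀ q ∈ cone s, (¬ ∀ r < t, q.1 r = true) → q ∉ U t}
  have hA : ¬ A₁.Countable ∨ ¬ A₂.Countable := by
    by_contra! h
    refine hs ((h.1.union h.2).mono fun t ht => ?_)
    have := hUf t ht.1
    rw [ht.2] at this
    exact this.imp (fun h => ⟨ht, h⟩) fun h => ⟨ht, h⟩
  have hcone : ∀ t ∈ B, f t = s → cone t ⊆ cone s := fun t ht hts q hq =>
    apply_of_le q (hts ▸ (hf t ht).le) hq
  rcases hA with hA | hA
  · obtain ⟨t, ht, t', ht', h1, h2⟩ := hT.exists_not_Iio_subset hA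
    have key : ∀ t ∈ A₁, ∀ t' ∈ A₁, ¬ Set.Iio t ⊆ Set.Iio t' → ¬ Set.Iio t' ⊆ Set.Iio t →
        ¬ ClosureLE (U t) (U t') := by
      intro t ht t' ht' h1 h2 hle
      obtain ⟨x, hxf, hx⟩ := hUt t' ht'.1.1
      have hxU : x ∈ U t := ht.2 x (hcone t' ht'.1.1 ht'.1.2 hx)
        (not_forall_lt_apply hT.isTree h1 h2 hx)
      rw [(h𝒰.1.1 _ (hU t' ht'.1.1)).frontier_eq] at hxf
      rcases hle with hle | hle
      · exact hxf.2 (hle (subset_closure hxU))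
      · exact hxf.2 (hle ▸ hxU)
    rcases h𝒰.1.2 _ (hU t ht.1.1) _ (hU t' ht'.1.1) with h | h
    · exact key t ht t' ht' h1 h2 h
    · exact key t' ht' t ht h2 h1 h
  · obtain ⟨t, ht, t', ht', h1, h2⟩ := hT.exists_not_Iio_subset hA
    have key : ∀ t ∈ A₂, ∀ t' ∈ A₂, ¬ Set.Iio t ⊆ Set.Iio t' → ¬ Set.Iio t' ⊆ Set.Iio t →
        ¬ ClosureLE (U t) (U t') := by
      intro t ht t' ht' h1 h2 hle
      obtain ⟨x, hxf, hx⟩ := hUt t ht.1.1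
      have hxU : x ∈ closure (U t') := by
        rcases hle with hle | hle
        · exact subset_closure (hle (frontier_subset_closure hxf))
        · exact hle ▸ frontier_subset_closure hxf
      obtain ⟨y, hy, hyU⟩ := mem_closure_iff.1 hxU _ (isClopen_cone t).isOpen hx
      exact ht'.2 y (hcone t ht.1.1 ht.1.2 hy) (not_forall_lt_apply hT.isTree h2 h1 hy) hyU
    rcases h𝒰.1.2 _ (hU t ht.1.1) _ (hU t' ht'.1.1) with h | h
    · exact key t ht t' ht' h1 h2 h
    · exact key t' ht' t ht h2 h1 h

end PathSpace

end SuslinTunnel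

theorem proposition2p15 :
    SuslinTunnel.SuslinHypothesis ↔
      ∀ (K : Type*) [TopologicalSpace K] [T2Space K] [CompactSpace K],
        SuslinTunnel.IsCCC K → SuslinTunnel.IsZeroDimensional K →
          SuslinTunnel.HasNoIsolatedPoints K → SuslinTunnel.HasTunnel K := by
  refine ⟨fun hSH K _ _ _ => hSH.hasTunnel, fun h T _ hT => ?_⟩
  -- A copy of `T` in the universe of the spaces `K`.
  let e : ULift T ≃o T := ⟨Equiv.ulift, Iff.rfl⟩
  have hT' := hT.of_orderIso e
  exact SuslinTunnel.not_hasTunnel_pathSpace hT' (h _ (SuslinTunnel.isCCC_pathSpace hT')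
    SuslinTunnel.isZeroDimensional_pathSpace (SuslinTunnel.hasNoIsolatedPoints_pathSpace hT'))
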